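/- Let $K$ be a field whose characteristic does not divide $12$ (characteristic $0$ is allowed), and let $\mathrm{A}_4$ be the alternating group on four letters. For a finite group $G$ and a finite dimensional $K$-vector space $V$ on which $G$ acts linearly, let $K[V]$ be the coordinate ring of $V$, i.e. the polynomial algebra over $K$ in the coordinate functions $x_1,\dots,x_n$ of $V$ with respect to a basis, with its standard grading and with the induced action of $G$ by $K$-algebra automorphisms (given by $g\cdot x_i = x_i\circ g^{-1}$). Let $K[V]^G=\{f\in K[V]\mid g\cdot f=f \text{ for all } g\in G\}$, and let $K[V]^G_{\le d}$ be the set of its elements of degree at most $d$. A subset $S\subseteq K[V]^G$ is called separating if, for any $v,w\in V$, the equalities $f(v)=f(w)$ for all $f\in S$ imply that $v$ and $w$ lie in the same $G$-orbit. Put $$\beta_{\mathrm{sep}}(G,V):=\min\{d\in\mathbb{N}_0\mid K[V]^G_{\le d}\text{ is separating}\},$$ $$\beta_{\mathrm{sep}}^K(G):=\sup\{\beta_{\mathrm{sep}}(G,V)\mid V\text{ a finite dimensional }G\text{-module over }K\}.$$ Then $$\beta_{\mathrm{sep}}^K(\mathrm{A}_4)=6.$$ -/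

import Mathlib

universe u v w x

namespace SepNoether

/-! In this file `ρ : Representation K G V` is a `G`-module over the field `K`, with a chosen basis `b`
of `V`. The coordinate ring `K[V]` is `MvPolynomial ι K`, the variable `X i` being the `i`-th
coordinate function with respect to `b`. -/

section Module

variable {K : Type u} {G : Type v} {V : Type w} {ι : Type x} [Field K] [Group G] [AddCommGroup V]
  [Module K V] [Fintype ι] [DecidableEq ι]

/-- The value `f(v)` of the polynomial `f ∈ K[V]` at the vector `v ∈ V`. -/
noncomputable def evalAt (b : Module.Basis ι K V) (v : V) (f : MvPolynomial ι K) : K :=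
  MvPolynomial.eval (fun i => b.repr v i) f

/-- The action of `g ∈ G` on `K[V]` by `K`-algebra endomorphisms: the coordinate function `x_i` is sent
to the linear form `x_i ∘ ρ(g⁻¹)`, written out in the coordinates. -/
noncomputable def act (b : Module.Basis ι K V) (ρ : Representation K G V) (g : G) :
    MvPolynomial ι K →ₐ[K] MvPolynomial ι K :=
  MvPolynomial.aeval fun i =>
    ∑ j, MvPolynomial.C (LinearMap.toMatrix b b (ρ g⁻¹) i j) * MvPolynomial.X j

/-- The defining property of the action on the coordinate ring: `(g · f)(v) = f(g⁻¹ v)`. -/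
theorem evalAt_act (b : Module.Basis ι K V) (ρ : Representation K G V) (g : G)
    (f : MvPolynomial ι K) (v : V) :
    evalAt b v (act b ρ g f) = evalAt b (ρ g⁻¹ v) f := by
  have key : ∀ i, b.repr (ρ g⁻¹ v) i = ∑ j, LinearMap.toMatrix b b (ρ g⁻¹) i j * b.repr v j := by
    intro i
    rw [← LinearMap.toMatrix_mulVec_repr b b (ρ g⁻¹) v]
    rfl
  unfold evalAt act
  induction f using MvPolynomial.induction_on with
  | C a => simp
  | add p q hp hq => simp only [map_add, hp, hq]
  | mul_X p i hp =>
    rw [map_mul, map_mul, hp, map_mul, MvPolynomial.aeval_X, MvPolynomial.eval_X, key i]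
    simp

/-- The algebra `K[V]^G` of polynomial invariants. -/
noncomputable def invariants (b : Module.Basis ι K V) (ρ : Representation K G V) :
    Subalgebra K (MvPolynomial ι K) where
  carrier := {f | ∀ g : G, act b ρ g f = f}
  mul_mem' hp hq g := by rw [map_mul, hp g, hq g]
  add_mem' hp hq g := by rw [map_add, hp g, hq g]
  algebraMap_mem' c g := (act b ρ g).commutes c

/-- `K[V]^G_{≤ d}`, the invariants of degree at most `d`. -/
def invariantsLE (b : Module.Basis ι K V) (ρ : Representation K G V) (d : ℕ) :
    Set (MvPolynomial ι K) :=
  {f | f ∈ invariants b ρ ∧ f.totalDegree ≤ d}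

/-- A set `S` of invariants is separating if any two vectors on which all members of `S` agree lie in
the same `G`-orbit. -/
def IsSeparatingSet (b : Module.Basis ι K V) (ρ : Representation K G V)
    (S : Set (MvPolynomial ι K)) : Prop :=
  S ⊆ invariants b ρ ∧
    ∀ v w : V, (∀ f ∈ S, evalAt b v f = evalAt b w f) → ∃ g : G, ρ g v = w

/-- `β_sep(G, V)`: the least `d ∈ ℕ` such that `K[V]^G_{≤ d}` is a separating set
(it would be `⊤` if there were no such `d`). A linear change of coordinates preserves degrees, so
that the value does not depend on the basis `b`. -/
noncomputable def sepNoetherNumberOf (b : Module.Basis ι K V) (ρ : Representation K G V) : ℕ∞ :=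
  ⨅ (d : ℕ) (_ : IsSeparatingSet b ρ (invariantsLE b ρ d)), (d : ℕ∞)

end Module

/-- `β_sep^K(G)`, the separating Noether number of `G` over `K`: the supremum of `β_sep(G, V)` over all
finite dimensional `G`-modules `V` over `K` (each taken with its bases). -/
noncomputable def sepNoetherNumber (K : Type u) [Field K] (G : Type v) [Group G] : ℕ∞ :=
  ⨆ (V : Type u) (_ : AddCommGroup V) (_ : Module K V) (n : ℕ) (b : Module.Basis (Fin n) K V)
    (ρ : Representation K G V), sepNoetherNumberOf b ρ

end SepNoether

/-!
The upper bound holds over every field of characteristic not dividing `12`, without eigenvectors of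
the elements of order three, because one may pass to a domain over `K`. Averaging over the group
shows (`IsPolyFun.eq_of_invariantsLE`) that vectors which agree on all invariants of degree at most
`6` also agree under every invariant polynomial function of degree at most `6` with values in a
commutative `K`-algebra. The Klein four-group splits a module into its fixed vectors and
three eigenspaces permuted cyclically by a three-cycle, so that a vector amounts to three pairs
`(uᵢ, xᵢ)`, in which the `uᵢ` are the cyclic translates of its fixed part; the four-group changes an
even number of the signs of the `xᵢ`, and the three-cycle shifts the pairs. Embed the module linearly
in `K[X]` by `φ` and put `Bᵢ = φ(uᵢ) + φ(xᵢ)² Y` in `K[X][Y]`. The elementary symmetric functions and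
the difference product of the `Bᵢ` are invariant of degree at most `6`, and they determine the triple
up to cyclic shifts (`cyclic_shift_of_symm_eq`). After a shift only the signs of the `xᵢ` are open,
and the invariant `φ(x₀)φ(x₁)φ(x₂)` settles them (`exists_rho_eq_of_sq_eq`).

For the lower bound, consider the permutation representation on `K⁴`. A monomial of degree at most
`5` in four variables has two equal exponents, so that invariants of degree at most `5` under the
alternating group are symmetric (`rename_eq_of_forall_even`). They do not separate `(0, 1, 2, 3)` from
`(1, 0, 2, 3)`, which lie in different orbits since `0, 1, 2, 3` are distinct in `K`.
-/

namespace SepNoether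

open MvPolynomial
open scoped Polynomial

/-! ### The averaging argument -/

section Averaging

variable {K : Type u} {G : Type v} {V : Type w} {ι : Type x} [Field K] [Group G] [AddCommGroup V]
  [Module K V]

theorem totalDegree_aeval_le_of_totalDegree_le_one {R σ τ : Type*} [CommSemiring R]
    (g : σ → MvPolynomial τ R) (hg : ∀ i, (g i).totalDegree ≤ 1) (f : MvPolynomial σ R) :
    (aeval g f).totalDegree ≤ f.totalDegree := by
  rw [aeval_def, eval₂_eq]
  refine totalDegree_finsetSum_le fun m hm => ?_
  refine (totalDegree_mul _ _).trans ?_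
  rw [MvPolynomial.algebraMap_eq, totalDegree_C, zero_add]
  refine (totalDegree_finsetProd _ _).trans ?_
  refine le_trans (Finset.sum_le_sum fun i _ => ?_) (le_totalDegree hm)
  exact (totalDegree_pow _ _).trans (by simpa using Nat.mul_le_mul_left (m i) (hg i))

theorem totalDegree_act_le [Fintype ι] [DecidableEq ι]
    (b : Module.Basis ι K V) (ρ : Representation K G V) (g : G)
    (f : MvPolynomial ι K) : (act b ρ g f).totalDegree ≤ f.totalDegree := by
  refine totalDegree_aeval_le_of_totalDegree_le_one _ (fun i => ?_) f
  refine totalDegree_finsetSum_le fun j _ => (totalDegree_mul _ _).trans ?_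
  simp

theorem act_act [Fintype ι] [DecidableEq ι]
    (b : Module.Basis ι K V) (ρ : Representation K G V) (g h : G)
    (f : MvPolynomial ι K) : act b ρ g (act b ρ h f) = act b ρ (g * h) f := by
  suffices H : (act b ρ g).comp (act b ρ h) = act b ρ (g * h) from DFunLike.congr_fun H f
  refine MvPolynomial.algHom_ext fun i => ?_
  have hC : ∀ r : K, act b ρ g (C r) = C r := fun r => (act b ρ g).commutes r
  have hX : ∀ (k : G) (i : ι), act b ρ k (X i) =
      ∑ j, C (LinearMap.toMatrix b b (ρ k⁻¹) i j) * X j := fun k i => by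
    simp [act]
  have hM : LinearMap.toMatrix b b (ρ (g * h)⁻¹) =
      LinearMap.toMatrix b b (ρ h⁻¹) * LinearMap.toMatrix b b (ρ g⁻¹) := by
    rw [mul_inv_rev, map_mul, LinearMap.toMatrix_mul]
  simp only [AlgHom.comp_apply, hX, map_sum, map_mul, hC, hM, Matrix.mul_apply, Finset.mul_sum,
    Finset.sum_mul]
  rw [Finset.sum_comm]
  simp only [mul_assoc]

variable {D : Type*} [CommRing D] [Algebra K D]

/-- `F : V → D` is a polynomial function of degree at most `d` with coefficients in the `K`-algebra
`D`, in the coordinates with respect to the basis `b`. -/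
def IsPolyFun (b : Module.Basis ι K V) (d : ℕ) (F : V → D) : Prop :=
  ∃ f : MvPolynomial ι D, f.totalDegree ≤ d ∧
    ∀ v, F v = eval (fun i => algebraMap K D (b.repr v i)) f

namespace IsPolyFun

variable {b : Module.Basis ι K V} {d e : ℕ} {F F' : V → D}

theorem const (c : D) : IsPolyFun b 0 (fun _ => c) := ⟨C c, by simp, by simp⟩

theorem mul (hF : IsPolyFun b d F) (hF' : IsPolyFun b e F') :
    IsPolyFun b (d + e) (fun v => F v * F' v) := by
  obtain ⟨f, hf, h⟩ := hF
  obtain ⟨f', hf', h'⟩ := hF'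
  exact ⟨f * f', (totalDegree_mul _ _).trans (add_le_add hf hf'), fun v => by simp [h, h']⟩

theorem add (hF : IsPolyFun b d F) (hF' : IsPolyFun b d F') :
    IsPolyFun b d (fun v => F v + F' v) := by
  obtain ⟨f, hf, h⟩ := hF
  obtain ⟨f', hf', h'⟩ := hF'
  exact ⟨f + f', (totalDegree_add _ _).trans (max_le hf hf'), fun v => by simp [h, h']⟩

theorem sub (hF : IsPolyFun b d F) (hF' : IsPolyFun b d F') :
    IsPolyFun b d (fun v => F v - F' v) := by
  obtain ⟨f, hf, h⟩ := hF
  obtain ⟨f', hf', h'⟩ := hF'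
  exact ⟨f - f', (totalDegree_sub _ _).trans (max_le hf hf'), fun v => by simp [h, h']⟩

theorem mono (hF : IsPolyFun b d F) (h : d ≤ e) : IsPolyFun b e F := by
  obtain ⟨f, hf, h'⟩ := hF
  exact ⟨f, hf.trans h, h'⟩

theorem linear [Fintype ι] (L : V →ₗ[K] D) : IsPolyFun b 1 (fun v => L v) := by
  refine ⟨∑ i, C (L (b i)) * X i, ?_, fun v => ?_⟩
  · refine totalDegree_finsetSum_le fun j _ => (totalDegree_mul _ _).trans ?_
    rw [totalDegree_C, zero_add]
    exact (totalDegree_monomial_le _ _).trans (by simp)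
  · change L v = _
    conv_lhs => rw [← b.sum_repr v]
    rw [map_sum, map_sum]
    simp [Algebra.smul_def, mul_comm]

end IsPolyFun

/-- A functional on the coefficients turns a `D`-valued polynomial function into a polynomial in
`K[V]`, which averaging over `G` makes invariant without raising the degree. As functionals separate
the points of `D`, invariant `D`-valued polynomial functions separate no more than the
invariants of the same degree. -/
theorem IsPolyFun.eq_of_invariantsLE [Fintype ι] [DecidableEq ι] [Fintype G]
    (hG : (Fintype.card G : K) ≠ 0)
    {b : Module.Basis ι K V} {ρ : Representation K G V} {d : ℕ} {F : V → D}
    (hF : IsPolyFun b d F) (hinv : ∀ g v, F (ρ g v) = F v) {v w : V}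
    (hvw : ∀ f ∈ invariantsLE b ρ d, evalAt b v f = evalAt b w f) : F v = F w := by
  obtain ⟨f, hf, hFf⟩ := hF
  rw [← sub_eq_zero, ← Module.forall_dual_apply_eq_zero_iff K]
  intro φ
  rw [map_sub, sub_eq_zero]
  obtain ⟨p, hp⟩ : ∃ p : MvPolynomial ι K, p = ∑ m ∈ f.support, monomial m (φ (coeff m f)) :=
    ⟨_, rfl⟩
  have hpe : ∀ v, evalAt b v p = φ (F v) := by
    intro v
    rw [hFf, eval_eq', map_sum, evalAt, hp, map_sum]
    refine Finset.sum_congr rfl fun m _ => ?_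
    rw [eval_monomial, Finsupp.prod_fintype _ _ (by simp)]
    have : ∏ i, algebraMap K D (b.repr v i) ^ m i = algebraMap K D (∏ i, b.repr v i ^ m i) := by
      rw [map_prod]
      exact Finset.prod_congr rfl fun i _ => (map_pow _ _ _).symm
    rw [this, mul_comm (coeff m f), ← Algebra.smul_def, map_smul, smul_eq_mul, mul_comm]
  have hpd : p.totalDegree ≤ d := by
    rw [hp]
    exact totalDegree_finsetSum_le fun m hm =>
      (totalDegree_monomial_le _ _).trans ((le_totalDegree hm).trans hf)
  obtain ⟨q, hq⟩ : ∃ q : MvPolynomial ι K,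
      q = C (Fintype.card G : K)⁻¹ * ∑ g : G, act b ρ g p := ⟨_, rfl⟩
  have hqe : ∀ v, evalAt b v q = φ (F v) := by
    intro v
    have : ∀ g : G, eval (fun i => b.repr v i) (act b ρ g p) = φ (F v) := fun g => by
      have := evalAt_act b ρ g p v
      rw [hpe, hinv] at this
      exact this
    simp [hq, evalAt, this, hG]
  have hqi : q ∈ invariantsLE b ρ d := by
    refine ⟨fun g => ?_, ?_⟩
    · have hC : act b ρ g (C (Fintype.card G : K)⁻¹) = C (Fintype.card G : K)⁻¹ :=
        (act b ρ g).commutes _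
      rw [hq, map_mul, map_sum, hC]
      simp only [act_act]
      rw [Fintype.sum_equiv (Equiv.mulLeft g) (fun h => act b ρ (g * h) p)
        (fun h => act b ρ h p) fun _ => rfl]
    · rw [hq]
      refine (totalDegree_mul _ _).trans ?_
      rw [totalDegree_C, zero_add]
      exact totalDegree_finsetSum_le fun g _ =>
        (totalDegree_act_le b ρ g p).trans hpd
  rw [← hqe, ← hqe, hvw q hqi]

end Averaging

/-! ### Triples up to cyclic shifts -/

/-- The elementary symmetric functions determine a triple up to permutation, and the difference
product, which odd permutations negate, then determines it up to cyclic shifts. -/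
theorem cyclic_shift_of_symm_eq {D : Type*} [CommRing D] [IsDomain D] (h2 : (2 : D) ≠ 0)
    {p q r p' q' r' : D} (h₁ : p' + q' + r' = p + q + r)
    (h₂ : p' * q' + q' * r' + r' * p' = p * q + q * r + r * p) (h₃ : p' * q' * r' = p * q * r)
    (h₄ : (p' - q') * (q' - r') * (r' - p') = (p - q) * (q - r) * (r - p)) :
    (p' = p ∧ q' = q ∧ r' = r) ∨ (p' = q ∧ q' = r ∧ r' = p) ∨ (p' = r ∧ q' = p ∧ r' = q) := by
  -- The case in which the first entries agree; the others reduce to it by a cyclic shift.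
  have key : ∀ p q r q' r' : D, p + q' + r' = p + q + r →
      p * q' + q' * r' + r' * p = p * q + q * r + r * p →
      (p - q') * (q' - r') * (r' - p) = (p - q) * (q - r) * (r - p) →
      (q' = q ∧ r' = r) ∨ (p = q ∧ q' = r ∧ r' = p) ∨ (p = r ∧ q' = p ∧ r' = q) := by
    intro p q r q' r' h₁ h₂ h₄
    have hr : r' = q + r - q' := by linear_combination h₁
    subst hr
    have h : (q' - q) * (q' - r) = 0 := by linear_combination -h₂
    rcases mul_eq_zero.1 h with h | h
    · obtain rfl := sub_eq_zero.1 h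
      exact Or.inl ⟨rfl, by ring⟩
    · obtain rfl := sub_eq_zero.1 h
      have h0 : 2 * ((p - q) * (q - q') * (q' - p)) = 0 := by linear_combination -h₄
      rcases mul_eq_zero.1 ((mul_eq_zero.1 h0).resolve_left h2) with h | h
      · rcases mul_eq_zero.1 h with h | h
        · obtain rfl := sub_eq_zero.1 h
          exact Or.inr (Or.inl ⟨rfl, rfl, by ring⟩)
        · obtain rfl := sub_eq_zero.1 h
          exact Or.inl ⟨rfl, by ring⟩
      · obtain rfl := sub_eq_zero.1 h
        exact Or.inr (Or.inr ⟨rfl, rfl, by ring⟩)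
  have h : (p' - p) * (p' - q) * (p' - r) = 0 := by
    linear_combination p' ^ 2 * h₁ - p' * h₂ + h₃
  rcases mul_eq_zero.1 h with h | h
  · rcases mul_eq_zero.1 h with h | h
    · obtain rfl := sub_eq_zero.1 h
      have := key p' q r q' r' h₁ h₂ h₄
      tauto
    · obtain rfl := sub_eq_zero.1 h
      have := key p' r p q' r' (by linear_combination h₁) (by linear_combination h₂)
        (by linear_combination h₄)
      tauto
  · obtain rfl := sub_eq_zero.1 h
    have := key p' p q q' r' (by linear_combination h₁) (by linear_combination h₂)
      (by linear_combination h₄)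
    tauto

/-! ### Elements of the alternating group -/

/-- The double transposition `(0 1)(2 3)`. -/
def dblA : alternatingGroup (Fin 4) :=
  ⟨Equiv.swap 0 1 * Equiv.swap 2 3, Equiv.Perm.mem_alternatingGroup.2 (by decide)⟩

/-- The double transposition `(0 2)(1 3)`. -/
def dblB : alternatingGroup (Fin 4) :=
  ⟨Equiv.swap 0 2 * Equiv.swap 1 3, Equiv.Perm.mem_alternatingGroup.2 (by decide)⟩

/-- The double transposition `(0 3)(1 2)`. -/
def dblC : alternatingGroup (Fin 4) :=
  ⟨Equiv.swap 0 3 * Equiv.swap 1 2, Equiv.Perm.mem_alternatingGroup.2 (by decide)⟩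

/-- The three-cycle `(1 2 3)`; conjugation by it maps `dblA` to `dblB` to `dblC` to `dblA`. -/
def cyc : alternatingGroup (Fin 4) :=
  ⟨Equiv.swap 1 2 * Equiv.swap 2 3, Equiv.Perm.mem_alternatingGroup.2 (by decide)⟩

theorem exists_eq_pow_mul (g : alternatingGroup (Fin 4)) :
    ∃ i j k : Fin 3, g = dblA ^ (i : ℕ) * dblB ^ (j : ℕ) * cyc ^ (k : ℕ) := by
  revert g
  decide

theorem card_alternatingGroup_four : Fintype.card (alternatingGroup (Fin 4)) = 12 := by
  decide

/-! ### The upper bound -/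

section UpperBound

variable {K : Type u} {V : Type w} [Field K] [AddCommGroup V] [Module K V]

/-- Four times the projection of `V` onto the vectors fixed by the Klein four-group. -/
def fixedPart (ρ : Representation K (alternatingGroup (Fin 4)) V) : V →ₗ[K] V :=
  1 + ρ dblA + ρ dblB + ρ dblC

/-- Four times the projection of `V` onto the vectors fixed by `dblA` and negated by `dblB` and
`dblC`. -/
def signPart (ρ : Representation K (alternatingGroup (Fin 4)) V) : V →ₗ[K] V :=
  1 + ρ dblA - ρ dblB - ρ dblC

variable (ρ : Representation K (alternatingGroup (Fin 4)) V)

theorem rho_rho_of_mul_eq {g h k : alternatingGroup (Fin 4)} (H : g * h = k) (v : V) :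
    ρ g (ρ h v) = ρ k v := by
  rw [← H, map_mul, Module.End.mul_apply]

theorem rho_rho_of_mul_eq_mul {g h g' h' : alternatingGroup (Fin 4)} (H : g * h = g' * h')
    (v : V) : ρ g (ρ h v) = ρ g' (ρ h' v) := by
  rw [rho_rho_of_mul_eq ρ H, rho_rho_of_mul_eq ρ rfl]

theorem dblA_dblA (v : V) : ρ dblA (ρ dblA v) = v := by
  rw [rho_rho_of_mul_eq ρ (k := 1) (by decide)]; simp

theorem dblB_dblB (v : V) : ρ dblB (ρ dblB v) = v := by
  rw [rho_rho_of_mul_eq ρ (k := 1) (by decide)]; simp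

theorem dblC_dblC (v : V) : ρ dblC (ρ dblC v) = v := by
  rw [rho_rho_of_mul_eq ρ (k := 1) (by decide)]; simp

theorem dblA_dblB (v : V) : ρ dblA (ρ dblB v) = ρ dblC v := rho_rho_of_mul_eq ρ (by decide) v
theorem dblB_dblA (v : V) : ρ dblB (ρ dblA v) = ρ dblC v := rho_rho_of_mul_eq ρ (by decide) v
theorem dblA_dblC (v : V) : ρ dblA (ρ dblC v) = ρ dblB v := rho_rho_of_mul_eq ρ (by decide) v
theorem dblC_dblA (v : V) : ρ dblC (ρ dblA v) = ρ dblB v := rho_rho_of_mul_eq ρ (by decide) v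
theorem dblB_dblC (v : V) : ρ dblB (ρ dblC v) = ρ dblA v := rho_rho_of_mul_eq ρ (by decide) v
theorem dblC_dblB (v : V) : ρ dblC (ρ dblB v) = ρ dblA v := rho_rho_of_mul_eq ρ (by decide) v

theorem cyc_dblA (v : V) : ρ cyc (ρ dblA v) = ρ dblB (ρ cyc v) :=
  rho_rho_of_mul_eq_mul ρ (by decide) v
theorem cyc_dblB (v : V) : ρ cyc (ρ dblB v) = ρ dblC (ρ cyc v) :=
  rho_rho_of_mul_eq_mul ρ (by decide) v
theorem cyc_dblC (v : V) : ρ cyc (ρ dblC v) = ρ dblA (ρ cyc v) :=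
  rho_rho_of_mul_eq_mul ρ (by decide) v

theorem cyc_cyc_cyc (v : V) : ρ cyc (ρ cyc (ρ cyc v)) = v := by
  rw [rho_rho_of_mul_eq ρ rfl, rho_rho_of_mul_eq ρ (k := 1) (by decide)]; simp

theorem fixedPart_apply (v : V) : fixedPart ρ v = v + ρ dblA v + ρ dblB v + ρ dblC v := rfl

theorem signPart_apply (v : V) : signPart ρ v = v + ρ dblA v - ρ dblB v - ρ dblC v := rfl

theorem fixedPart_dblA (v : V) : fixedPart ρ (ρ dblA v) = fixedPart ρ v := by
  simp only [fixedPart_apply, dblA_dblA, dblB_dblA, dblC_dblA]; abel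

theorem fixedPart_dblB (v : V) : fixedPart ρ (ρ dblB v) = fixedPart ρ v := by
  simp only [fixedPart_apply, dblA_dblB, dblB_dblB, dblC_dblB]; abel

theorem fixedPart_dblC (v : V) : fixedPart ρ (ρ dblC v) = fixedPart ρ v := by
  simp only [fixedPart_apply, dblA_dblC, dblB_dblC, dblC_dblC]; abel

theorem signPart_dblA (v : V) : signPart ρ (ρ dblA v) = signPart ρ v := by
  simp only [signPart_apply, dblA_dblA, dblB_dblA, dblC_dblA]; abel

theorem signPart_dblB (v : V) : signPart ρ (ρ dblB v) = -signPart ρ v := by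
  simp only [signPart_apply, dblA_dblB, dblB_dblB, dblC_dblB]; abel

theorem signPart_dblC (v : V) : signPart ρ (ρ dblC v) = -signPart ρ v := by
  simp only [signPart_apply, dblA_dblC, dblB_dblC, dblC_dblC]; abel

/-- The three sign components, transported by `cyc` to a common eigenspace, and the fixed component
together determine a vector. -/
theorem eq_of_parts_eq (h2 : (2 : K) ≠ 0) {v w : V} (hu : fixedPart ρ v = fixedPart ρ w)
    (hx : signPart ρ v = signPart ρ w) (hy : signPart ρ (ρ cyc v) = signPart ρ (ρ cyc w))
    (hz : signPart ρ (ρ cyc (ρ cyc v)) = signPart ρ (ρ cyc (ρ cyc w))) : v = w := by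
  have h : ∀ v : V, (2 * 2 : K) • v = fixedPart ρ v + signPart ρ v +
      ρ cyc (ρ cyc (signPart ρ (ρ cyc v))) + ρ cyc (signPart ρ (ρ cyc (ρ cyc v))) := by
    intro v
    simp only [fixedPart_apply, signPart_apply, map_add, map_sub, cyc_dblA, cyc_dblB, cyc_dblC,
      cyc_cyc_cyc, mul_smul, two_smul]
    abel
  have h4 : (2 * 2 : K) • v = (2 * 2 : K) • w := by rw [h v, h w, hu, hx, hy, hz]
  exact smul_right_injective V (mul_ne_zero h2 h2) h4

/-- A function invariant under `dblA`, `dblB` and `cyc` is invariant under the whole group, since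
these generate it. -/
theorem invariant_of_generators {D : Type*} {F : V → D} (hA : ∀ v, F (ρ dblA v) = F v)
    (hB : ∀ v, F (ρ dblB v) = F v) (hT : ∀ v, F (ρ cyc v) = F v)
    (g : alternatingGroup (Fin 4)) (v : V) : F (ρ g v) = F v := by
  have hpow : ∀ h : alternatingGroup (Fin 4), (∀ v, F (ρ h v) = F v) →
      ∀ (n : ℕ) (v : V), F (ρ (h ^ n) v) = F v := by
    intro h hh n
    induction n with
    | zero => simp
    | succ n ih =>
      intro v
      rw [pow_succ, map_mul, Module.End.mul_apply, ih, hh]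
  obtain ⟨i, j, k, rfl⟩ := exists_eq_pow_mul g
  simp only [map_mul ρ, Module.End.mul_apply]
  rw [hpow _ hA, hpow _ hB, hpow _ hT]

/-- If two vectors have the same fixed component, sign components equal up to sign, and the same
product of the sign components, then they are in the same orbit of the Klein four-group: the number
of sign changes is even, or can be made even since one of the components is zero. -/
theorem exists_rho_eq_of_sq_eq (h2 : (2 : K) ≠ 0) {D : Type*} [CommRing D] [IsDomain D]
    (h2D : (2 : D) ≠ 0) (Φ : V → D) (hΦ : Function.Injective Φ) (hΦn : ∀ v, Φ (-v) = -Φ v)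
    {v w : V} (hu : fixedPart ρ w = fixedPart ρ v)
    (hx : Φ (signPart ρ w) ^ 2 = Φ (signPart ρ v) ^ 2)
    (hy : Φ (signPart ρ (ρ cyc w)) ^ 2 = Φ (signPart ρ (ρ cyc v)) ^ 2)
    (hz : Φ (signPart ρ (ρ cyc (ρ cyc w))) ^ 2 = Φ (signPart ρ (ρ cyc (ρ cyc v))) ^ 2)
    (hT : Φ (signPart ρ w) * Φ (signPart ρ (ρ cyc w)) * Φ (signPart ρ (ρ cyc (ρ cyc w))) =
      Φ (signPart ρ v) * Φ (signPart ρ (ρ cyc v)) * Φ (signPart ρ (ρ cyc (ρ cyc v)))) :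
    ∃ g, ρ g v = w := by
  have h1 : signPart ρ w = signPart ρ v → signPart ρ (ρ cyc w) = signPart ρ (ρ cyc v) →
      signPart ρ (ρ cyc (ρ cyc w)) = signPart ρ (ρ cyc (ρ cyc v)) → ∃ g, ρ g v = w :=
    fun hx hy hz => ⟨1, by simpa using (eq_of_parts_eq ρ h2 hu hx hy hz).symm⟩
  have hA : signPart ρ w = signPart ρ v → signPart ρ (ρ cyc w) = -signPart ρ (ρ cyc v) →
      signPart ρ (ρ cyc (ρ cyc w)) = -signPart ρ (ρ cyc (ρ cyc v)) → ∃ g, ρ g v = w :=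
    fun hx hy hz => ⟨dblA, (eq_of_parts_eq ρ h2 (by rw [hu, fixedPart_dblA])
      (by rw [hx, signPart_dblA]) (by rw [hy, cyc_dblA, signPart_dblB])
      (by rw [hz, cyc_dblA, cyc_dblB, signPart_dblC])).symm⟩
  have hB : signPart ρ w = -signPart ρ v → signPart ρ (ρ cyc w) = -signPart ρ (ρ cyc v) →
      signPart ρ (ρ cyc (ρ cyc w)) = signPart ρ (ρ cyc (ρ cyc v)) → ∃ g, ρ g v = w :=
    fun hx hy hz => ⟨dblB, (eq_of_parts_eq ρ h2 (by rw [hu, fixedPart_dblB])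
      (by rw [hx, signPart_dblB]) (by rw [hy, cyc_dblB, signPart_dblC])
      (by rw [hz, cyc_dblB, cyc_dblC, signPart_dblA])).symm⟩
  have hC : signPart ρ w = -signPart ρ v → signPart ρ (ρ cyc w) = signPart ρ (ρ cyc v) →
      signPart ρ (ρ cyc (ρ cyc w)) = -signPart ρ (ρ cyc (ρ cyc v)) → ∃ g, ρ g v = w :=
    fun hx hy hz => ⟨dblC, (eq_of_parts_eq ρ h2 (by rw [hu, fixedPart_dblC])
      (by rw [hx, signPart_dblC]) (by rw [hy, cyc_dblC, signPart_dblA])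
      (by rw [hz, cyc_dblC, cyc_dblA, signPart_dblB])).symm⟩
  have hsq : ∀ x y : V, Φ x ^ 2 = Φ y ^ 2 → x = y ∨ x = -y := fun x y h => by
    rcases sq_eq_sq_iff_eq_or_eq_neg.1 h with h | h
    · exact Or.inl (hΦ h)
    · exact Or.inr (hΦ (h.trans (hΦn y).symm))
  have h0 : ∀ x : V, Φ x = 0 → x = -x := fun x h => hΦ (by rw [hΦn, h, neg_zero])
  generalize signPart ρ v = x at *
  generalize signPart ρ (ρ cyc v) = y at *
  generalize signPart ρ (ρ cyc (ρ cyc v)) = z at *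
  -- An odd number of sign changes negates the product, so that some component vanishes.
  have hodd : Φ x * Φ y * Φ z = -(Φ x * Φ y * Φ z) → x = -x ∨ y = -y ∨ z = -z := fun h => by
    have h' : 2 * (Φ x * Φ y * Φ z) = 0 := by linear_combination h
    rcases mul_eq_zero.1 ((mul_eq_zero.1 h').resolve_left h2D) with h | h
    · rcases mul_eq_zero.1 h with h | h
      · exact Or.inl (h0 x h)
      · exact Or.inr (Or.inl (h0 y h))
    · exact Or.inr (Or.inr (h0 z h))
  rcases hsq _ _ hx with ex | ex <;> rcases hsq _ _ hy with ey | ey <;>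
    rcases hsq _ _ hz with ez | ez
  · exact h1 ex ey ez
  · rw [ex, ey, ez, hΦn] at hT
    rcases hodd (by linear_combination -hT) with h | h | h
    · exact hC (ex.trans h) ey ez
    · exact hA ex (ey.trans h) ez
    · exact h1 ex ey (ez.trans h.symm)
  · rw [ex, ey, ez, hΦn] at hT
    rcases hodd (by linear_combination -hT) with h | h | h
    · exact hB (ex.trans h) ey ez
    · exact h1 ex (ey.trans h.symm) ez
    · exact hA ex ey (ez.trans h)
  · exact hA ex ey ez
  · rw [ex, ey, ez, hΦn] at hT
    rcases hodd (by linear_combination -hT) with h | h | h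
    · exact h1 (ex.trans h.symm) ey ez
    · exact hB ex (ey.trans h) ez
    · exact hC ex ey (ez.trans h)
  · exact hC ex ey ez
  · exact hB ex ey ez
  · rw [ex, ey, ez, hΦn, hΦn, hΦn] at hT
    rcases hodd (by linear_combination -hT) with h | h | h
    · exact hA (ex.trans h.symm) ey ez
    · exact hC ex (ey.trans h.symm) ez
    · exact hB ex ey (ez.trans h.symm)

/-- The polynomial `φ(u) + φ(x)² Y`, where `u` and `x` are the fixed and the sign component of `v`:
it records `u`, and `x` up to sign, in a single element of the domain `K[X][Y]`. -/
noncomputable def code (φ : V →ₗ[K] K[X]) (v : V) : K[X][X] :=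
  Polynomial.C (φ (fixedPart ρ v)) +
    Polynomial.X * (Polynomial.C (φ (signPart ρ v)) * Polynomial.C (φ (signPart ρ v)))

theorem code_eq_code_iff {φ : V →ₗ[K] K[X]} {v w : V} :
    code ρ φ v = code ρ φ w ↔ φ (fixedPart ρ v) = φ (fixedPart ρ w) ∧
      φ (signPart ρ v) ^ 2 = φ (signPart ρ w) ^ 2 := by
  have h0 : ∀ v, (code ρ φ v).coeff 0 = φ (fixedPart ρ v) := fun v => by simp [code]
  have h1 : ∀ v, (code ρ φ v).coeff 1 = φ (signPart ρ v) ^ 2 := fun v => by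
    simp [code, Polynomial.coeff_X_mul (n := 0), Polynomial.coeff_C, sq]
  refine ⟨fun h => ⟨?_, ?_⟩, fun h => ?_⟩
  · rw [← h0, ← h0, h]
  · rw [← h1, ← h1, h]
  · simp only [code, ← sq, ← map_pow, h.1, h.2]

theorem code_dblA (φ : V →ₗ[K] K[X]) (v : V) : code ρ φ (ρ dblA v) = code ρ φ v := by
  rw [code_eq_code_iff, fixedPart_dblA, signPart_dblA]; simp

theorem code_dblB (φ : V →ₗ[K] K[X]) (v : V) : code ρ φ (ρ dblB v) = code ρ φ v := by
  rw [code_eq_code_iff, fixedPart_dblB, signPart_dblB]; simp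

theorem code_dblC (φ : V →ₗ[K] K[X]) (v : V) : code ρ φ (ρ dblC v) = code ρ φ v := by
  rw [code_eq_code_iff, fixedPart_dblC, signPart_dblC]; simp

theorem isPolyFun_code {ι : Type x} [Fintype ι] (b : Module.Basis ι K V)
    (φ : V →ₗ[K] K[X]) (L : V →ₗ[K] V) : IsPolyFun b 2 (fun v => code ρ φ (L v)) := by
  have hu := IsPolyFun.linear (b := b)
    ((Polynomial.CAlgHom (R := K)).toLinearMap ∘ₗ φ ∘ₗ fixedPart ρ ∘ₗ L)
  have hx := IsPolyFun.linear (b := b)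
    ((Polynomial.CAlgHom (R := K)).toLinearMap ∘ₗ φ ∘ₗ signPart ρ ∘ₗ L)
  exact (hu.mono one_le_two).add
    (((IsPolyFun.const (Polynomial.X : K[X][X])).mul (hx.mul hx)).mono le_rfl)

theorem isSeparatingSet_invariantsLE_six {ι : Type x} [Fintype ι] [DecidableEq ι]
    (h2 : (2 : K) ≠ 0) (h12 : (12 : K) ≠ 0) (b : Module.Basis ι K V)
    (φ : V →ₗ[K] K[X]) (hφ : Function.Injective φ) :
    IsSeparatingSet b ρ (invariantsLE b ρ 6) := by
  refine ⟨fun f hf => hf.1, fun v w hvw => ?_⟩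
  have hG : (Fintype.card (alternatingGroup (Fin 4)) : K) ≠ 0 := by
    rw [card_alternatingGroup_four]; exact_mod_cast h12
  have h2D : (2 : K[X]) ≠ 0 := by
    rw [← map_ofNat Polynomial.C]; exact Polynomial.C_ne_zero.2 h2
  have h2D' : (2 : K[X][X]) ≠ 0 := by
    rw [← map_ofNat Polynomial.C]; exact Polynomial.C_ne_zero.2 h2D
  -- The codes of `v`, `cyc v`, `cyc² v` are permuted cyclically by `cyc`.
  let p : V → K[X][X] := fun v => code ρ φ v
  let q : V → K[X][X] := fun v => code ρ φ (ρ cyc v)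
  let r : V → K[X][X] := fun v => code ρ φ (ρ cyc (ρ cyc v))
  have hp : IsPolyFun b 2 p := isPolyFun_code ρ b φ LinearMap.id
  have hq : IsPolyFun b 2 q := isPolyFun_code ρ b φ (ρ cyc)
  have hr : IsPolyFun b 2 r := isPolyFun_code ρ b φ (ρ cyc ∘ₗ ρ cyc)
  have pA : ∀ v, p (ρ dblA v) = p v := fun v => code_dblA ρ φ v
  have pB : ∀ v, p (ρ dblB v) = p v := fun v => code_dblB ρ φ v
  have pT : ∀ v, p (ρ cyc v) = q v := fun v => rfl
  have qA : ∀ v, q (ρ dblA v) = q v := fun v => by simp only [q, cyc_dblA, code_dblB]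
  have qB : ∀ v, q (ρ dblB v) = q v := fun v => by simp only [q, cyc_dblB, code_dblC]
  have qT : ∀ v, q (ρ cyc v) = r v := fun v => rfl
  have rA : ∀ v, r (ρ dblA v) = r v := fun v => by simp only [r, cyc_dblA, cyc_dblB, code_dblC]
  have rB : ∀ v, r (ρ dblB v) = r v := fun v => by simp only [r, cyc_dblB, cyc_dblC, code_dblA]
  have rT : ∀ v, r (ρ cyc v) = p v := fun v => by simp only [r, p, cyc_cyc_cyc]
  have sep : ∀ F : V → K[X][X], IsPolyFun b 6 F → (∀ v, F (ρ dblA v) = F v) →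
      (∀ v, F (ρ dblB v) = F v) → (∀ v, F (ρ cyc v) = F v) → F w = F v := fun F hF hA hB hT =>
    hF.eq_of_invariantsLE hG (invariant_of_generators ρ hA hB hT) fun f hf => (hvw f hf).symm
  have e₁ := sep (fun v => p v + q v + r v)
    (((hp.add hq).add hr).mono (by norm_num))
    (fun v => by simp only [pA, qA, rA])
    (fun v => by simp only [pB, qB, rB]) (fun v => by simp only [pT, qT, rT]; ring)
  have e₂ := sep (fun v => p v * q v + q v * r v + r v * p v)
    ((((hp.mul hq).add (hq.mul hr)).add (hr.mul hp)).mono (by norm_num))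
    (fun v => by simp only [pA, qA, rA])
    (fun v => by simp only [pB, qB, rB]) (fun v => by simp only [pT, qT, rT]; ring)
  have e₃ := sep (fun v => p v * q v * r v)
    (((hp.mul hq).mul hr).mono (by norm_num))
    (fun v => by simp only [pA, qA, rA])
    (fun v => by simp only [pB, qB, rB]) (fun v => by simp only [pT, qT, rT]; ring)
  have e₄ := sep (fun v => (p v - q v) * (q v - r v) * (r v - p v))
    ((((hp.sub hq).mul (hq.sub hr)).mul (hr.sub hp)).mono (by norm_num))
    (fun v => by simp only [pA, qA, rA])
    (fun v => by simp only [pB, qB, rB]) (fun v => by simp only [pT, qT, rT]; ring)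
  let T : V → K[X] := fun v =>
    φ (signPart ρ v) * φ (signPart ρ (ρ cyc v)) * φ (signPart ρ (ρ cyc (ρ cyc v)))
  have hT : IsPolyFun b 6 T :=
    (((IsPolyFun.linear (φ ∘ₗ signPart ρ)).mul
      (IsPolyFun.linear (φ ∘ₗ signPart ρ ∘ₗ ρ cyc))).mul
      (IsPolyFun.linear (φ ∘ₗ signPart ρ ∘ₗ ρ cyc ∘ₗ ρ cyc))).mono (by norm_num)
  have TT : ∀ v, T (ρ cyc v) = T v := fun v => by simp only [T, cyc_cyc_cyc]; ring
  have hTinv : ∀ g v, T (ρ g v) = T v := invariant_of_generators ρ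
    (fun v => by
      simp only [T, cyc_dblA, cyc_dblB, signPart_dblA, signPart_dblB, signPart_dblC, map_neg]
      ring)
    (fun v => by
      simp only [T, cyc_dblB, cyc_dblC, signPart_dblA, signPart_dblB, signPart_dblC, map_neg]
      ring) TT
  have e₅ : T w = T v := hT.eq_of_invariantsLE hG hTinv (fun f hf => (hvw f hf).symm)
  -- Vectors with the same codes, in the same order, are in one orbit.
  have key : ∀ v', p w = p v' → q w = q v' → r w = r v' → T w = T v' → ∃ g, ρ g v' = w := by
    intro v' hp hq hr hT
    rw [code_eq_code_iff] at hp hq hr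
    exact exists_rho_eq_of_sq_eq ρ h2 h2D φ hφ (fun v => map_neg φ v) (hφ hp.1) hp.2 hq.2 hr.2 hT
  rcases cyclic_shift_of_symm_eq h2D' e₁ e₂ e₃ e₄ with ⟨hp, hq, hr⟩ | ⟨hp, hq, hr⟩ | ⟨hp, hq, hr⟩
  · exact key v hp hq hr e₅
  · obtain ⟨g, hg⟩ := key (ρ cyc v) hp hq (hr.trans (rT v).symm) (e₅.trans (TT v).symm)
    exact ⟨g * cyc, by rw [map_mul, Module.End.mul_apply, hg]⟩
  · obtain ⟨g, hg⟩ := key (ρ cyc (ρ cyc v)) hp (hq.trans (rT v).symm)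
      (hr.trans ((rT (ρ cyc v)).trans (pT v)).symm) (e₅.trans ((TT _).trans (TT v)).symm)
    exact ⟨g * cyc * cyc, by simp only [map_mul, Module.End.mul_apply, hg]⟩

/-- A finite dimensional space embeds into `K[X]`. -/
theorem exists_injective_linearMap_polynomial {n : ℕ} (b : Module.Basis (Fin n) K V) :
    ∃ φ : V →ₗ[K] K[X], Function.Injective φ := by
  refine ⟨(Polynomial.degreeLT K n).subtype ∘ₗ
    ((Polynomial.degreeLTEquiv K n).symm.toLinearMap ∘ₗ b.equivFun.toLinearMap), ?_⟩
  exact Subtype.val_injective.comp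
    ((Polynomial.degreeLTEquiv K n).symm.injective.comp b.equivFun.injective)

end UpperBound

/-! ### The lower bound -/

section LowerBound

variable (K : Type u) [Field K]

/-- The permutation representation of the alternating group on `K⁴`. -/
def permRep : Representation K (alternatingGroup (Fin 4)) (Fin 4 → K) where
  toFun g := LinearMap.funLeft K K (g⁻¹ : alternatingGroup (Fin 4)).1
  map_one' := by ext; simp [LinearMap.funLeft]
  map_mul' g h := by ext; simp [LinearMap.funLeft]

theorem act_permRep (g : alternatingGroup (Fin 4)) (f : MvPolynomial (Fin 4) K) :
    act (Pi.basisFun K (Fin 4)) (permRep K) g f = rename g.1 f := by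
  suffices H : act (Pi.basisFun K (Fin 4)) (permRep K) g = rename g.1 from DFunLike.congr_fun H f
  refine MvPolynomial.algHom_ext fun i => ?_
  simp [act, permRep, LinearMap.funLeft, Pi.single_apply]
  rfl

variable {K}

theorem six_le_degree_of_injective (m : Fin 4 →₀ ℕ) (hm : Function.Injective m) :
    6 ≤ m.degree := by
  have h : ∀ i j, i ≠ j → m i ≠ m j := fun i j => hm.ne
  have h01 := h 0 1 (by decide)
  have h02 := h 0 2 (by decide)
  have h03 := h 0 3 (by decide)
  have h12 := h 1 2 (by decide)
  have h13 := h 1 3 (by decide)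
  have h23 := h 2 3 (by decide)
  rw [Finsupp.degree_eq_sum, Fin.sum_univ_four]
  omega

/-- A monomial of degree less than `0 + 1 + 2 + 3` in four variables has two equal exponents, hence
is fixed by a transposition, so that its orbits under the symmetric and the alternating group
coincide. -/
theorem rename_eq_of_forall_even {f : MvPolynomial (Fin 4) K} (hd : f.totalDegree ≤ 5)
    (hf : ∀ g ∈ alternatingGroup (Fin 4), rename g f = f) (σ : Equiv.Perm (Fin 4)) :
    rename σ f = f := by
  by_cases hσ : σ ∈ alternatingGroup (Fin 4)
  · exact hf σ hσ
  ext m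
  by_cases hm : Function.Injective m
  · have h6 := six_le_degree_of_injective m hm
    have hz : ∀ f : MvPolynomial (Fin 4) K, f.totalDegree ≤ 5 → coeff m f = 0 := fun f hf =>
      coeff_eq_zero_of_totalDegree_lt (by
        rw [← Finsupp.degree_apply]
        omega)
    rw [hz f hd, hz _ ((totalDegree_rename_le _ _).trans hd)]
  · obtain ⟨i, j, hij, hne⟩ : ∃ i j, m i = m j ∧ i ≠ j := by
      simpa [Function.Injective] using hm
    have hfix : m.mapDomain (Equiv.swap i j) = m := by
      ext k
      rw [← Finsupp.equivMapDomain_eq_mapDomain, Finsupp.equivMapDomain_apply, Equiv.symm_swap]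
      by_cases h1 : k = i
      · subst h1; simp [hij]
      · by_cases h2 : k = j
        · subst h2; simp [hij]
        · rw [Equiv.swap_apply_of_ne_of_ne h1 h2]
    have heven : Equiv.swap i j * σ ∈ alternatingGroup (Fin 4) := by
      rw [Equiv.Perm.mem_alternatingGroup] at hσ ⊢
      rw [Equiv.Perm.sign_mul, Equiv.Perm.sign_swap hne,
        (Int.units_eq_one_or _).resolve_left hσ]
      rfl
    have := coeff_rename_mapDomain (Equiv.swap i j) (Equiv.injective _) (rename σ f) m
    rw [hfix, rename_rename, ← Equiv.Perm.coe_mul, hf _ heven] at this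
    exact this.symm

theorem not_isSeparatingSet_permRep (h2 : (2 : K) ≠ 0) (h3 : (3 : K) ≠ 0) {d : ℕ} (hd : d ≤ 5) :
    ¬ IsSeparatingSet (Pi.basisFun K (Fin 4)) (permRep K)
      (invariantsLE (Pi.basisFun K (Fin 4)) (permRep K) d) := by
  rintro ⟨-, h⟩
  let v : Fin 4 → K := ![0, 1, 2, 3]
  have hv : Function.Injective v := by
    have h21 : (2 : K) ≠ 1 := fun h => one_ne_zero (α := K) (by linear_combination h)
    have h31 : (3 : K) ≠ 1 := fun h => h2 (by linear_combination h)
    have h32 : (3 : K) ≠ 2 := fun h => one_ne_zero (α := K) (by linear_combination h)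
    intro i j hij
    fin_cases i <;> fin_cases j <;>
      simp [v, h2, h3, h21, h31, h32, h2.symm, h3.symm, h21.symm, h31.symm, h32.symm] at hij ⊢
  have hagree : ∀ f ∈ invariantsLE (Pi.basisFun K (Fin 4)) (permRep K) d,
      evalAt (Pi.basisFun K (Fin 4)) v f =
        evalAt (Pi.basisFun K (Fin 4)) (v ∘ Equiv.swap 0 1) f := by
    intro f hf
    have hs : rename (Equiv.swap 0 1) f = f :=
      rename_eq_of_forall_even (hf.2.trans hd) (fun g hg => by
        have := hf.1 ⟨g, hg⟩
        rwa [act_permRep] at this) (Equiv.swap 0 1)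
    have he : eval v (rename (Equiv.swap 0 1) f) = eval (v ∘ Equiv.swap 0 1) f := eval_rename _ _ _
    rw [hs] at he
    simpa only [evalAt, Pi.basisFun_repr] using he
  obtain ⟨g, hg⟩ := h v (v ∘ Equiv.swap 0 1) hagree
  have hgs : (g⁻¹ : alternatingGroup (Fin 4)).1 = Equiv.swap 0 1 :=
    Equiv.ext fun i => hv (congrFun hg i)
  have := (g⁻¹).2
  rw [hgs, Equiv.Perm.mem_alternatingGroup, Equiv.Perm.sign_swap (by decide)] at this
  exact absurd this (by decide)

end LowerBound

end SepNoether

theorem theorem4p2 {K : Type u} [Field K] (hchar : ¬ ringChar K ∣ 12) :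
    SepNoether.sepNoetherNumber K (alternatingGroup (Fin 4)) = 6 := by
  have h12 : (12 : K) ≠ 0 := fun h => hchar ((ringChar.spec K 12).1 (by exact_mod_cast h))
  have h2 : (2 : K) ≠ 0 := fun h => h12 (by linear_combination 6 * h)
  have h3 : (3 : K) ≠ 0 := fun h => h12 (by linear_combination 4 * h)
  refine le_antisymm ?_ ?_
  · refine iSup_le fun V => iSup_le fun _ => iSup_le fun _ => iSup_le fun n => iSup_le fun b =>
      iSup_le fun ρ => ?_
    obtain ⟨φ, hφ⟩ := SepNoether.exists_injective_linearMap_polynomial b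
    exact iInf₂_le 6 (SepNoether.isSeparatingSet_invariantsLE_six ρ h2 h12 b φ hφ)
  · refine le_trans ?_ (le_iSup_of_le (Fin 4 → K) <| le_iSup_of_le _ <| le_iSup_of_le _ <|
      le_iSup_of_le 4 <| le_iSup_of_le (Pi.basisFun K (Fin 4)) <|
      le_iSup_of_le (SepNoether.permRep K) le_rfl)
    refine le_iInf₂ fun d hd => ?_
    by_contra hlt
    have hd5 : d < 6 := by exact_mod_cast not_le.1 hlt
    exact SepNoether.not_isSeparatingSet_permRep h2 h3 (Nat.le_of_lt_succ hd5) hd
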